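/- Let $\alpha>1$. An instance of *energy efficient routing* consists of an undirected finite graph $G=(V,E)$ (parallel edges allowed), requests $i\in[N]$ with terminals $s_i,t_i\in V$ and (related) weights $w_i\in\mathbb Z_{\ge 1}$, and numbers $\sigma_e\ge 0$, $\xi_e>0$ for $e\in E$. Let $P_i$ be the set of (edge sets of) $s_i$–$t_i$ paths without repeated edges; assume $P_i\neq\emptyset$ for all $i$. The cost of a profile $p\in\prod_i P_i$ is $C(p)=\sum_e F_e(l_e^p)$, where $l_e^p=\sum_{i:\,e\in p_i}w_i$, $F_e(0)=0$ and $F_e(l)=\sigma_e+\xi_e l^\alpha$ for $l>0$; let $C^*=\min_p C(p)$. The randomized algorithm CPR works as follows. 1. Partition each request $i$ into $w_i$ sub-requests $i_1,\dots,i_{w_i}$ of weight $1$ with the same terminals. A *fractional solution* $x$ assigns to every sub-request $i_j$ a probability vector $(x_{i_j}(r))_{r\in P_i}$. Put $l_e^x(i)=\sum_{j}\sum_{r\in P_i:\,e\in r}x_{i_j}(r)$ and $l_e^x=\sum_i l^x_e(i)$. 2. Compute a fractional solution $x$ minimizing the convex function $\sum_e\bigl(W_e(l_e^x)+\xi_e\sum_i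 w_i^{\alpha-1}l_e^x(i)\bigr)$, where, with $\theta_e=\bigl(\frac{\sigma_e}{(\alpha-1)\xi_e}\bigr)^{1/\alpha}$, $$W_e(l)=\begin{cases}\zeta_e\, l, & 0\le l\le\max\{1,\theta_e\},\\ \sigma_e+\xi_e l^\alpha, & l>\max\{1,\theta_e\},\end{cases}\qquad \zeta_e=\begin{cases}\sigma_e+\xi_e,&\theta_e<1,\\ \alpha\xi_e\bigl(\frac{\sigma_e}{(\alpha-1)\xi_e}\bigr)^{1-1/\alpha},&\theta_e\ge 1.\end{cases}$$ 3. Independently for all sub-requests, choose $\widehat p_{i_j}\in P_i$ at random with $\Pr[\widehat p_{i_j}=r]=x_{i_j}(r)$. 4. Independently for all requests (and of step 3), choose $j(i)\in\{1,\dots,w_i\}$ uniformly at random, and output the profile $p^\sharp$ with $p^\sharp_i=\widehat p_{i_{j(i)}}$. **Theorem.** There is a constant $K>0$ depending only on $\alpha$ such that, for every such instance, the minimum in step 2 is attained and, whichever minimizer $x$ is used, $$\mathbb E\bigl[C(p^\sharp)\bigr]\;\le\;K\Bigl(1+\bigl(\max_{e\in E}\tfrac{\sigma_e}{\xi_e}\bigr)^{1/\alpha}\Bigr)\,C^*$$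 (with the maximum read as $0$ if $E=\emptyset$). That is, CPR has (expected) approximation ratio $O\bigl(1+(\max_e\sigma_e/\xi_e)^{1/\alpha}\bigr)$. -/

import Mathlib

open MeasureTheory
open scoped ENNReal

noncomputable section

/-- `IsWalk G s l t`: the edge sequence `l` is traversed by a walk from `s` to `t` in the
undirected multigraph `G`. -/
inductive IsWalk {V E : Type*} (G : Graph V E) : V → List E → V → Prop
  | nil {v : V} (hv : v ∈ G.vertexSet) : IsWalk G v [] v
  | cons {u v t : V} {e : E} {l : List E} (h : G.IsLink e u v) (hl : IsWalk G v l t) :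
      IsWalk G u (e :: l) t

/-- An instance of energy efficient routing (EER), apart from the global load exponent `α`:
an undirected multigraph with vertex set `V` and edge set `E`, requests `i : Fin N` with terminals
`src i`, `dst i` and related integral weights `weight i ≥ 1`, startup costs `σ e ≥ 0` and speed
scaling factors `ξ e > 0`. -/
structure EERInstance (V E : Type*) where
  graph : Graph V E
  vertexSet_eq : graph.vertexSet = Set.univ
  edgeSet_eq : graph.edgeSet = Set.univ
  N : ℕ
  src : Fin N → V
  dst : Fin N → V
  weight : Fin N → ℕ
  one_le_weight : ∀ i, 1 ≤ weight i
  σ : E → ℝ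
  σ_nonneg : ∀ e, 0 ≤ σ e
  ξ : E → ℝ
  ξ_pos : ∀ e, 0 < ξ e

namespace EERInstance

variable {V E : Type*} (I : EERInstance V E)

/-- The reply collection `P i`: the edge sets of the paths without repeated edges that connect
the two terminals of request `i`. -/
def Reply (i : Fin I.N) : Type _ :=
  {r : Finset E // ∃ l : List E, l.Nodup ∧ IsWalk I.graph (I.src i) l (I.dst i) ∧
    ∀ e, e ∈ r ↔ e ∈ l}

instance (i : Fin I.N) [Fintype E] : Finite (I.Reply i) := by
  unfold Reply; infer_instance

instance (i : Fin I.N) [Fintype E] : Fintype (I.Reply i) := Fintype.ofFinite _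

instance (i : Fin I.N) : MeasurableSpace (I.Reply i) := ⊤

instance (i : Fin I.N) : DiscreteMeasurableSpace (I.Reply i) :=
  inferInstanceAs (@DiscreteMeasurableSpace _ ⊤)

/-- Every request can be served. -/
def Feasible : Prop := ∀ i, Nonempty (I.Reply i)

/-- A solution of the instance: one reply for every request. -/
abbrev Profile : Type _ := ∀ i : Fin I.N, I.Reply i

open Classical in
/-- The load on edge `e` under the profile `p`. -/
def load (p : I.Profile) (e : E) : ℕ :=
  ∑ i : Fin I.N, if e ∈ (p i).1 then I.weight i else 0

/-- The energy consumption cost function of edge `e`, with load exponent `α`. -/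
def edgeCost (α : ℝ) (e : E) (l : ℕ) : ℝ :=
  if l = 0 then 0 else I.σ e + I.ξ e * (l : ℝ) ^ α

/-- The total cost of the profile `p`. -/
def cost [Fintype E] (α : ℝ) (p : I.Profile) : ℝ := ∑ e, I.edgeCost α e (I.load p e)

/-- The minimum total cost of a solution (of a feasible instance). -/
def optCost [Fintype E] (α : ℝ) : ℝ := ⨅ p : I.Profile, I.cost α p

/-- `max_e σ_e / ξ_e` (and `0` if there are no edges). -/
def maxRatio : ℝ := ⨆ e, I.σ e / I.ξ e

/-! ### The convex program of CPR -/

/-- The sub-requests: request `i` is partitioned into `weight i` sub-requests of unit weight, with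
the terminals of `i`. -/
abbrev SubRequest : Type := Σ i : Fin I.N, Fin (I.weight i)

/-- Assignments of a real number to every sub-request and every reply of it. -/
abbrev FracProfile : Type _ := ∀ s : I.SubRequest, I.Reply s.1 → ℝ

/-- A fractional solution for the sub-requests: every sub-request (of weight one) is split among
its replies. -/
def IsFractional [Fintype E] (x : I.FracProfile) : Prop :=
  ∀ s, x s ∈ stdSimplex ℝ (I.Reply s.1)

open Classical in
/-- The load that the sub-requests of request `i` induce on edge `e`. -/
def fracLoadOf [Fintype E] (x : I.FracProfile) (i : Fin I.N) (e : E) : ℝ :=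
  ∑ j : Fin (I.weight i), ∑ r : I.Reply i, if e ∈ r.1 then x ⟨i, j⟩ r else 0

/-- The load that all sub-requests induce on edge `e`. -/
def fracLoad [Fintype E] (x : I.FracProfile) (e : E) : ℝ := ∑ i, I.fracLoadOf x i e

/-- The load `(σ_e / ((α - 1) ξ_e)) ^ (1 / α)` at which the line through the origin that is tangent
to the curve `σ_e + ξ_e l ^ α` touches it. -/
def tangentLoad (α : ℝ) (e : E) : ℝ := (I.σ e / ((α - 1) * I.ξ e)) ^ (1 / α)

/-- The slope `ζ_e` of the linear part of the convexified cost. -/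
def slope (α : ℝ) (e : E) : ℝ :=
  if I.tangentLoad α e < 1 then I.σ e + I.ξ e
  else α * I.ξ e * (I.σ e / ((α - 1) * I.ξ e)) ^ (1 - 1 / α)

/-- The convexified cost `W_e` of edge `e` as a function of its (real) load. -/
def convexCost (α : ℝ) (e : E) (l : ℝ) : ℝ :=
  if l ≤ max 1 (I.tangentLoad α e) then I.slope α e * l else I.σ e + I.ξ e * l ^ α

/-- The objective function of the convex program:
`∑_e (W_e + ξ_e ∑_i w_i ^ (α - 1) l_e(i))`. -/
def objective [Fintype E] (α : ℝ) (x : I.FracProfile) : ℝ :=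
  ∑ e, (I.convexCost α e (I.fracLoad x e) +
    I.ξ e * ∑ i, (I.weight i : ℝ) ^ (α - 1) * I.fracLoadOf x i e)

/-- `x` is an optimal fractional solution of the convex program. -/
def IsOptimalFractional [Fintype E] (α : ℝ) (x : I.FracProfile) : Prop :=
  I.IsFractional x ∧ ∀ y, I.IsFractional y → I.objective α x ≤ I.objective α y

/-! ### The two rounding steps of CPR -/

/-- First rounding: independently, every sub-request `s` picks the reply `r` with probability
`x s r`. -/
def roundLaw [Fintype E] (x : I.FracProfile) : Measure (∀ s : I.SubRequest, I.Reply s.1) :=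
  Measure.pi fun s => ∑ r : I.Reply s.1, ENNReal.ofReal (x s r) • Measure.dirac r

/-- Second rounding: independently, every request `i` picks one of its `weight i` sub-requests
uniformly at random. -/
def selectLaw : Measure (∀ i : Fin I.N, Fin (I.weight i)) :=
  Measure.pi fun i => ProbabilityTheory.uniformOn (Set.univ : Set (Fin (I.weight i)))

/-- The distribution of the output of CPR when the convex program is solved by `x`: the two
roundings are independent, and request `i` is served by the reply of the sub-request it picked. -/
def cprLaw [Fintype E] (x : I.FracProfile) : Measure I.Profile :=
  ((I.roundLaw x).prod I.selectLaw).map fun z i => z.1 ⟨i, z.2 i⟩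

lemma isProbabilityMeasure_cprLaw [Fintype E] {x : I.FracProfile} (hx : I.IsFractional x) :
    IsProbabilityMeasure (I.cprLaw x) := by
  have h1 : ∀ s : I.SubRequest, IsProbabilityMeasure
      (∑ r : I.Reply s.1, ENNReal.ofReal (x s r) • Measure.dirac r) := fun s => ⟨by
    simp only [Measure.coe_finsetSum, Measure.coe_smul, Finset.sum_apply, Pi.smul_apply,
      measure_univ, smul_eq_mul, mul_one]
    rw [← ENNReal.ofReal_sum_of_nonneg fun r _ => (hx s).1 r, (hx s).2, ENNReal.ofReal_one]⟩
  have h2 : ∀ i : Fin I.N, IsProbabilityMeasure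
      (ProbabilityTheory.uniformOn (Set.univ : Set (Fin (I.weight i)))) := fun i =>
    ProbabilityTheory.isProbabilityMeasure_uniformOn Set.finite_univ
      ⟨⟨0, I.one_le_weight i⟩, trivial⟩
  have h3 : IsProbabilityMeasure (I.roundLaw x) := by unfold roundLaw; infer_instance
  have h4 : IsProbabilityMeasure I.selectLaw := by unfold selectLaw; infer_instance
  unfold cprLaw
  exact Measure.isProbabilityMeasure_map (Measurable.of_discrete).aemeasurable

/-- The expected total cost of the output of CPR. -/
def expectedCost [Fintype E] (α : ℝ) (x : I.FracProfile) : ℝ :=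
  ∫ p, I.cost α p ∂(I.cprLaw x)

end EERInstance

end

/-! The expected cost is bounded edge by edge. The two roundings together serve the requests
independently, and request `i` uses `e` with probability `l_e(i) / w_i` (`cprLaw_eq_pi`,
`integral_ite_mem`). The load on `e` is thus a sum of independent variables with values in `{0,
w_i}`, whose mean is `l_e` and whose `α`-th moments add up to `∑ w_i ^ (α - 1) l_e(i)`. Up to
constants in `α`, Rosenthal's inequality bounds the `α`-th moment of the load by this sum, which is
the extra term of the objective, plus `l_e ^ α`. The latter together with the expected startup cost
is at most `(1 + θ_e) W_e(l_e)` (`startup_mul_min_add_le`); this is the source of the factor `θ_e`,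
which is of order `(σ_e / ξ_e) ^ (1 / α)`.

Conversely, an optimal profile is a feasible point of the convex program with objective at most `2
C*` (`objective_fracOfProfile_le`), so the minimum is at most that. -/

noncomputable section

/-! ### Power inequalities and moments of independent sums -/

lemma Real.add_rpow_le_two_rpow_mul {a b β : ℝ} (ha : 0 ≤ a) (hb : 0 ≤ b) (hβ : 0 ≤ β) :
    (a + b) ^ β ≤ 2 ^ β * (a ^ β + b ^ β) := by
  have hm : 0 ≤ max a b := ha.trans (le_max_left _ _)
  calc (a + b) ^ β ≤ (2 * max a b) ^ β := by
        apply Real.rpow_le_rpow (by positivity) _ hβ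
        linarith [le_max_left a b, le_max_right a b]
    _ = 2 ^ β * (max a b) ^ β := Real.mul_rpow (by norm_num) hm
    _ ≤ 2 ^ β * (a ^ β + b ^ β) := by
        gcongr
        rcases max_choice a b with h | h <;> rw [h] <;>
          linarith [Real.rpow_nonneg ha β, Real.rpow_nonneg hb β]

/-- Young's inequality for the exponents `α` and `α / (α - 1)`. -/
lemma Real.mul_rpow_sub_one_le {α a b : ℝ} (hα : 1 < α) (ha : 0 ≤ a) (hb : 0 ≤ b) :
    α * (a * b ^ (α - 1)) ≤ a ^ α + (α - 1) * b ^ α := by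
  have hpq : α.HolderConjugate (α / (α - 1)) := Real.HolderConjugate.conjExponent hα
  have h := Real.young_inequality_of_nonneg ha (Real.rpow_nonneg hb (α - 1)) hpq
  have h0 : α - 1 ≠ 0 := by linarith
  rw [← Real.rpow_mul hb, mul_div_cancel₀ _ h0] at h
  calc α * (a * b ^ (α - 1)) ≤ α * (a ^ α / α + b ^ α / (α / (α - 1))) := by gcongr
    _ = a ^ α + (α - 1) * b ^ α := by field_simp

lemma Real.rpow_sub_one_mul_self {α a : ℝ} (hα : 1 < α) (ha : 0 ≤ a) :
    a ^ (α - 1) * a = a ^ α := by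
  rw [← Real.rpow_add_one' ha (by linarith)]
  ring_nf

/-- A Rosenthal inequality: the `α`-th moment of a sum of independent nonnegative random
variables. -/
theorem ProbabilityTheory.iIndepFun.integral_sum_rpow_le {Ω ι : Type*} [Finite Ω]
    [MeasurableSpace Ω] [DiscreteMeasurableSpace Ω] [Fintype ι] {μ : Measure Ω}
    [IsProbabilityMeasure μ] {X : ι → Ω → ℝ} (hX : iIndepFun X μ) (h0 : ∀ i ω, 0 ≤ X i ω)
    {α : ℝ} (hα : 1 < α) :
    ∫ ω, (∑ i, X i ω) ^ α ∂μ ≤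
      α * 2 ^ (α - 1) * ∑ i, ∫ ω, X i ω ^ α ∂μ
        + (2 ^ (α - 1)) ^ α * (∑ i, ∫ ω, X i ω ∂μ) ^ α := by
  classical
  have hint : ∀ f : Ω → ℝ, Integrable f μ := fun f => Integrable.of_finite
  set c : ℝ := 2 ^ (α - 1) with hc
  have hc0 : 0 ≤ c := by positivity
  set m : ℝ := ∑ i, ∫ ω, X i ω ∂μ with hm
  have hm0 : 0 ≤ m := Finset.sum_nonneg fun i _ => integral_nonneg (h0 i)
  have hS0 : ∀ ω, 0 ≤ ∑ i, X i ω := fun ω => Finset.sum_nonneg fun i _ => h0 i ω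
  -- With `S = ∑ X k`, write `S ^ α = ∑ S ^ (α - 1) * X i`. In each term `S = X i + R` with `R`
  -- independent of `X i`, so the mixed expectation factors.
  have hterm : ∀ i, ∫ ω, (∑ k, X k ω) ^ (α - 1) * X i ω ∂μ ≤
      c * (∫ ω, X i ω ^ α ∂μ +
        (∫ ω, (∑ k, X k ω) ^ (α - 1) ∂μ) * ∫ ω, X i ω ∂μ) := by
    intro i
    set R : Ω → ℝ := ∑ k ∈ Finset.univ.erase i, X k with hR
    have hRapp : ∀ ω, R ω = ∑ k ∈ Finset.univ.erase i, X k ω := fun ω => Finset.sum_apply _ _ _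
    have hR0 : ∀ ω, 0 ≤ R ω := fun ω => by
      rw [hRapp]; exact Finset.sum_nonneg fun k _ => h0 k ω
    have hsplit : ∀ ω, ∑ k, X k ω = X i ω + R ω := fun ω => by
      rw [hRapp, Finset.add_sum_erase _ (fun k => X k ω) (Finset.mem_univ i)]
    have hind : IndepFun (fun ω => R ω ^ (α - 1)) (X i) μ :=
      (hX.indepFun_finsetSum_of_notMem (fun _ => Measurable.of_discrete)
        (Finset.notMem_erase i _)).comp (φ := fun y : ℝ => y ^ (α - 1)) (ψ := id)
        (by fun_prop) measurable_id
    have hprod : ∫ ω, R ω ^ (α - 1) * X i ω ∂μ =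
        (∫ ω, R ω ^ (α - 1) ∂μ) * ∫ ω, X i ω ∂μ :=
      hind.integral_mul_eq_mul_integral (hint _).aestronglyMeasurable
        (hint _).aestronglyMeasurable
    calc ∫ ω, (∑ k, X k ω) ^ (α - 1) * X i ω ∂μ
        ≤ ∫ ω, c * (X i ω ^ α + R ω ^ (α - 1) * X i ω) ∂μ := by
          refine integral_mono (hint _) (hint _) fun ω => ?_
          have := Real.add_rpow_le_two_rpow_mul (h0 i ω) (hR0 ω) (sub_nonneg.2 hα.le)
          simp only [hsplit, ← Real.rpow_sub_one_mul_self hα (h0 i ω)]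
          calc _ ≤ _ := mul_le_mul_of_nonneg_right this (h0 i ω)
            _ = _ := by rw [hc]; ring
      _ = c * (∫ ω, X i ω ^ α ∂μ + (∫ ω, R ω ^ (α - 1) ∂μ) * ∫ ω, X i ω ∂μ) := by
          rw [integral_const_mul, integral_add (hint _) (hint _), hprod]
      _ ≤ _ := by
          gcongr ?_ * (_ + ?_ * _)
          · exact integral_nonneg (h0 i)
          · refine integral_mono (hint _) (hint _) fun ω => ?_
            exact Real.rpow_le_rpow (hR0 ω) (by linarith [hsplit ω, h0 i ω]) (by linarith)
  have hmain : ∫ ω, (∑ i, X i ω) ^ α ∂μ ≤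
      c * ∑ i, ∫ ω, X i ω ^ α ∂μ + (c * m) * ∫ ω, (∑ k, X k ω) ^ (α - 1) ∂μ := by
    calc ∫ ω, (∑ i, X i ω) ^ α ∂μ
        = ∑ i, ∫ ω, (∑ k, X k ω) ^ (α - 1) * X i ω ∂μ := by
          rw [← integral_finsetSum _ fun _ _ => hint _]
          congr 1; ext ω
          rw [← Finset.mul_sum, Real.rpow_sub_one_mul_self hα (hS0 ω)]
      _ ≤ _ := Finset.sum_le_sum fun i _ => hterm i
      _ = _ := by
          rw [← Finset.mul_sum, Finset.sum_add_distrib, ← Finset.mul_sum]; ring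
  -- Young trades the moment of order `α - 1` for `α - 1` copies of the `α`-th moment. Since `hmain`
  -- is multiplied by `α`, one copy survives on the left.
  have hyoung : α * ((c * m) * ∫ ω, (∑ k, X k ω) ^ (α - 1) ∂μ) ≤
      (c * m) ^ α + (α - 1) * ∫ ω, (∑ k, X k ω) ^ α ∂μ := by
    have h := integral_mono (hint _) (hint _) (fun ω =>
      Real.mul_rpow_sub_one_le hα (mul_nonneg hc0 hm0) (hS0 ω)) (μ := μ)
    simpa [integral_const_mul, integral_add (hint _) (hint _)] using h
  rw [Real.mul_rpow hc0 hm0] at hyoung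
  nlinarith [mul_le_mul_of_nonneg_left hmain (show (0 : ℝ) ≤ α by linarith)]

/-! ### The edge cost and its convexification -/

namespace EERInstance

variable {V E : Type*} (I : EERInstance V E)

lemma tangentLoad_nonneg {α : ℝ} (hα : 1 < α) (e : E) : 0 ≤ I.tangentLoad α e :=
  Real.rpow_nonneg (div_nonneg (I.σ_nonneg e) (mul_nonneg (by linarith) (I.ξ_pos e).le)) _

lemma startup_eq {α : ℝ} (hα : 1 < α) (e : E) :
    I.σ e = (α - 1) * I.ξ e * I.tangentLoad α e ^ α := by
  have h1 : 0 < (α - 1) * I.ξ e := mul_pos (by linarith) (I.ξ_pos e)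
  have h2 : 0 ≤ I.σ e / ((α - 1) * I.ξ e) := div_nonneg (I.σ_nonneg e) h1.le
  rw [tangentLoad, ← Real.rpow_mul h2, one_div, inv_mul_cancel₀ (by linarith), Real.rpow_one,
    mul_div_cancel₀ _ h1.ne']

lemma slope_of_one_le {α : ℝ} (hα : 1 < α) {e : E} (h : 1 ≤ I.tangentLoad α e) :
    I.slope α e = α * I.ξ e * I.tangentLoad α e ^ (α - 1) := by
  have h2 : 0 ≤ I.σ e / ((α - 1) * I.ξ e) :=
    div_nonneg (I.σ_nonneg e) (mul_nonneg (by linarith) (I.ξ_pos e).le)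
  rw [slope, if_neg h.not_gt, tangentLoad, ← Real.rpow_mul h2]
  congr 2
  field_simp

/-- The two branches of `W_e` agree at the breakpoint, which makes `W_e` continuous. -/
lemma slope_mul_max {α : ℝ} (hα : 1 < α) (e : E) :
    I.slope α e * max 1 (I.tangentLoad α e) =
      I.σ e + I.ξ e * max 1 (I.tangentLoad α e) ^ α := by
  rcases lt_or_ge (I.tangentLoad α e) 1 with h | h
  · rw [max_eq_left h.le, slope, if_pos h]; simp
  · rw [max_eq_right h, I.slope_of_one_le hα h, mul_assoc,
      Real.rpow_sub_one_mul_self hα (I.tangentLoad_nonneg hα e)]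
    linarith [I.startup_eq hα e]

lemma continuous_convexCost {α : ℝ} (hα : 1 < α) (e : E) : Continuous (I.convexCost α e) := by
  unfold convexCost
  refine Continuous.if_le (by fun_prop) ?_ continuous_id continuous_const ?_
  · exact continuous_const.add (continuous_const.mul
      (Real.continuous_rpow_const (by linarith)))
  · rintro l rfl
    exact I.slope_mul_max hα e

/-- The convexified cost bounds the expected cost of a randomly rounded load. -/
lemma startup_mul_min_add_le {α : ℝ} (hα : 1 < α) (e : E) {l : ℝ} (hl : 0 ≤ l) :
    I.σ e * min 1 l + I.ξ e * l ^ α ≤ (1 + I.tangentLoad α e) * I.convexCost α e l := by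
  have hσ := I.σ_nonneg e
  have hξ := (I.ξ_pos e).le
  have hθ := I.tangentLoad_nonneg hα e
  have hmin : I.σ e * min 1 l ≤ I.σ e * l := by gcongr; exact min_le_right _ _
  rw [convexCost]
  split_ifs with h
  · rcases lt_or_ge (I.tangentLoad α e) 1 with h1 | h1
    · rw [max_eq_left h1.le] at h
      have h2 : l ^ α ≤ l := Real.rpow_le_self_of_le_one hl h hα.le
      rw [slope, if_pos h1]
      have h3 : 0 ≤ I.tangentLoad α e * ((I.σ e + I.ξ e) * l) := by positivity
      nlinarith [mul_le_mul_of_nonneg_left h2 hξ]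
    · rw [max_eq_right h1] at h
      set θ := I.tangentLoad α e
      have h2 : l ^ (α - 1) ≤ θ ^ (α - 1) := Real.rpow_le_rpow hl h (by linarith)
      have hA : I.ξ e * l ^ α ≤ α * (I.ξ e * (θ ^ (α - 1) * l)) := by
        rw [← Real.rpow_sub_one_mul_self hα hl]
        calc I.ξ e * (l ^ (α - 1) * l) ≤ I.ξ e * (θ ^ (α - 1) * l) := by gcongr
          _ ≤ _ := le_mul_of_one_le_left (by positivity) hα.le
      -- Here the factor `θ` is lost: a small load `l` pays up to `σ l = (α - 1) ξ θ ^ α l` for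
      -- startup, while `W_e` charges only `α ξ θ ^ (α - 1) l`.
      have hB : I.σ e * l ≤ α * (I.ξ e * (θ ^ (α - 1) * θ) * l) := by
        rw [I.startup_eq hα e, ← Real.rpow_sub_one_mul_self hα hθ]
        have : 0 ≤ I.ξ e * (θ ^ (α - 1) * θ) * l := by positivity
        change (α - 1) * I.ξ e * (θ ^ (α - 1) * θ) * l ≤ _
        linarith
      rw [I.slope_of_one_le hα h1]
      change _ ≤ (1 + θ) * (α * I.ξ e * θ ^ (α - 1) * l)
      linarith
  · have h1 : I.σ e * min 1 l ≤ I.σ e := mul_le_of_le_one_right hσ (min_le_left _ _)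
    have h2 : 0 ≤ I.tangentLoad α e * (I.σ e + I.ξ e * l ^ α) := by positivity
    linarith

/-- At integral loads, the convexified cost is at most the cost. -/
lemma convexCost_natCast_le {α : ℝ} (hα : 1 < α) (e : E) (l : ℕ) :
    I.convexCost α e l ≤ I.edgeCost α e l := by
  have hσ := I.σ_nonneg e
  have hξ := (I.ξ_pos e).le
  have hθ := I.tangentLoad_nonneg hα e
  rcases Nat.eq_zero_or_pos l with rfl | hl
  · simp [convexCost, edgeCost]
  have hl1 : (1 : ℝ) ≤ l := by exact_mod_cast hl
  rw [convexCost, edgeCost, if_neg hl.ne']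
  split_ifs with h
  · rcases lt_or_ge (I.tangentLoad α e) 1 with h1 | h1
    · rw [max_eq_left h1.le] at h
      -- Integrality matters: the only positive integral load on this linear piece is `1`, where
      -- both costs are `σ + ξ`.
      rw [le_antisymm h hl1, slope, if_pos h1]; simp
    -- Scaled by `ξ`, Young's inequality says that the tangent line at `θ` lies below the curve `σ +
    -- ξ l ^ α`.
    · have hy := Real.mul_rpow_sub_one_le hα (Nat.cast_nonneg l) hθ
      have h2 := mul_le_mul_of_nonneg_left hy hξ
      have h3 := I.startup_eq hα e
      rw [I.slope_of_one_le hα h1]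
      linarith
  · rfl

lemma edgeCost_eq {α : ℝ} (hα : 1 < α) (e : E) (l : ℕ) :
    I.edgeCost α e l = I.σ e * min 1 (l : ℝ) + I.ξ e * (l : ℝ) ^ α := by
  rcases Nat.eq_zero_or_pos l with rfl | hl
  · simp [edgeCost, Real.zero_rpow (show α ≠ 0 by linarith)]
  · have hl1 : (1 : ℝ) ≤ l := by exact_mod_cast hl
    rw [edgeCost, if_neg hl.ne', min_eq_left hl1, mul_one]

lemma tangentLoad_le [Finite E] {α : ℝ} (hα : 1 < α) (e : E) :
    I.tangentLoad α e ≤ (1 / (α - 1)) ^ (1 / α) * I.maxRatio ^ (1 / α) := by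
  have hr : 0 ≤ I.σ e / I.ξ e := div_nonneg (I.σ_nonneg e) (I.ξ_pos e).le
  have hle : I.σ e / I.ξ e ≤ I.maxRatio :=
    le_ciSup (f := fun e => I.σ e / I.ξ e) (Set.finite_range _).bddAbove e
  have h1 : 0 ≤ 1 / (α - 1) := one_div_nonneg.2 (by linarith)
  rw [← Real.mul_rpow h1 (hr.trans hle), tangentLoad]
  have : I.σ e / ((α - 1) * I.ξ e) = 1 / (α - 1) * (I.σ e / I.ξ e) := by
    have := I.ξ_pos e
    field_simp
  rw [this]
  gcongr

/-! ### The convex program -/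

variable [Fintype E]

lemma continuous_objective {α : ℝ} (hα : 1 < α) : Continuous (I.objective α) := by
  have h1 : ∀ i e, Continuous fun x : I.FracProfile => I.fracLoadOf x i e := by
    intro i e
    unfold fracLoadOf
    refine continuous_finsetSum _ fun j _ => continuous_finsetSum _ fun r _ => ?_
    split_ifs <;> fun_prop
  have h2 : ∀ e, Continuous fun x : I.FracProfile => I.fracLoad x e := fun e =>
    continuous_finsetSum _ fun i _ => h1 i e
  refine continuous_finsetSum _ fun e _ => ?_
  exact ((I.continuous_convexCost hα e).comp (h2 e)).add (continuous_const.mul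
    (continuous_finsetSum _ fun i _ => continuous_const.mul (h1 i e)))

open Classical in
/-- The fractional solution that serves all sub-requests of a request like the profile `p`. -/
def fracOfProfile (p : I.Profile) : I.FracProfile := fun s => Pi.single (p s.1) 1

lemma isFractional_fracOfProfile (p : I.Profile) : I.IsFractional (I.fracOfProfile p) := by
  classical
  intro s
  simp only [fracOfProfile]
  convert single_mem_stdSimplex ℝ (p s.1)

/-- A continuous objective on a nonempty product of compact simplices. -/
lemma exists_isOptimalFractional {α : ℝ} (hα : 1 < α) (hI : I.Feasible) :
    ∃ x : I.FracProfile, I.IsOptimalFractional α x := by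
  have hc : IsCompact {x : I.FracProfile | I.IsFractional x} := by
    convert isCompact_univ_pi fun s : I.SubRequest => isCompact_stdSimplex ℝ (I.Reply s.1)
    ext x; simp [IsFractional, Set.mem_pi]
  obtain ⟨x, hx, hmin⟩ := hc.exists_isMinOn
    ⟨_, I.isFractional_fracOfProfile fun i => (hI i).some⟩ (I.continuous_objective hα).continuousOn
  exact ⟨x, hx, fun y hy => hmin hy⟩

open Classical in
lemma fracLoadOf_fracOfProfile (p : I.Profile) (i : Fin I.N) (e : E) :
    I.fracLoadOf (I.fracOfProfile p) i e = if e ∈ (p i).1 then (I.weight i : ℝ) else 0 := by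
  have : ∀ r : I.Reply i, (if e ∈ r.1 then (Pi.single (p i) 1 : I.Reply i → ℝ) r else 0) =
      if r = p i then (if e ∈ (p i).1 then 1 else 0) else 0 := by
    intro r
    by_cases h : r = p i
    · subst h; simp
    · simp [h]
  simp only [fracLoadOf, fracOfProfile, this]
  simp

open Classical in
omit [Fintype E] in
lemma load_cast (p : I.Profile) (e : E) :
    (I.load p e : ℝ) = ∑ i, if e ∈ (p i).1 then (I.weight i : ℝ) else 0 := by
  simp [load]

/-- Each half of the objective is at most the cost: `W_e` by its bound at integral loads, and the
extra term because a request using `e` has weight at most the load, so `∑ w_i ^ (α - 1) w_i ≤ l ^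
α`. -/
lemma objective_fracOfProfile_le {α : ℝ} (hα : 1 < α) (p : I.Profile) :
    I.objective α (I.fracOfProfile p) ≤ 2 * I.cost α p := by
  classical
  rw [cost, Finset.mul_sum]
  refine Finset.sum_le_sum fun e _ => ?_
  have hload : I.fracLoad (I.fracOfProfile p) e = I.load p e := by
    simp only [fracLoad, I.fracLoadOf_fracOfProfile, I.load_cast]
  have h1 := I.convexCost_natCast_le hα e (I.load p e)
  have h2 : ∑ i, (I.weight i : ℝ) ^ (α - 1) * I.fracLoadOf (I.fracOfProfile p) i e ≤
      (I.load p e : ℝ) ^ α := by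
    rw [← Real.rpow_sub_one_mul_self hα (Nat.cast_nonneg _)]
    conv_rhs => rw [I.load_cast p e, Finset.mul_sum, ← I.load_cast p e]
    refine Finset.sum_le_sum fun i _ => ?_
    rw [I.fracLoadOf_fracOfProfile]
    split_ifs with h
    · have hle : (I.weight i : ℝ) ≤ I.load p e := by
        rw [I.load_cast]
        have := Finset.single_le_sum (f := fun i => if e ∈ (p i).1 then (I.weight i : ℝ) else 0)
          (fun k _ => by positivity) (Finset.mem_univ i)
        simpa [h] using this
      gcongr
    · simp
  have h3 : I.ξ e * (I.load p e : ℝ) ^ α ≤ I.edgeCost α e (I.load p e) := by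
    rw [I.edgeCost_eq hα]
    have := I.σ_nonneg e
    have : 0 ≤ I.σ e * min 1 (I.load p e : ℝ) := by positivity
    linarith
  rw [hload]
  linarith [mul_le_mul_of_nonneg_left h2 (I.ξ_pos e).le]

lemma objective_le_optCost {α : ℝ} (hα : 1 < α) (hI : I.Feasible) {x : I.FracProfile}
    (hx : I.IsOptimalFractional α x) : I.objective α x ≤ 2 * I.optCost α := by
  have : Nonempty I.Profile := ⟨fun i => (hI i).some⟩
  obtain ⟨p, hp⟩ := exists_eq_ciInf_of_finite (f := fun p : I.Profile => I.cost α p)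
  rw [optCost, ← hp]
  exact (hx.2 _ (I.isFractional_fracOfProfile p)).trans (I.objective_fracOfProfile_le hα p)

/-! ### The law of the output of CPR -/

/-- The law of the reply that a sub-request picks in the first rounding. -/
def subLaw (x : I.FracProfile) (i : Fin I.N) (j : Fin (I.weight i)) : Measure (I.Reply i) :=
  ∑ r : I.Reply i, ENNReal.ofReal (x ⟨i, j⟩ r) • Measure.dirac r

/-- The law of the reply that serves request `i` in the output of CPR. -/
def replyLaw (x : I.FracProfile) (i : Fin I.N) : Measure (I.Reply i) :=
  ∑ j : Fin (I.weight i), (I.weight i : ℝ≥0∞)⁻¹ • I.subLaw x i j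

variable {I} {x : I.FracProfile}

lemma IsFractional.isProbabilityMeasure_subLaw (hx : I.IsFractional x) (i : Fin I.N)
    (j : Fin (I.weight i)) : IsProbabilityMeasure (I.subLaw x i j) := ⟨by
  simp only [subLaw, Measure.coe_finsetSum, Measure.coe_smul, Finset.sum_apply, Pi.smul_apply,
    measure_univ, smul_eq_mul, mul_one]
  rw [← ENNReal.ofReal_sum_of_nonneg fun r _ => (hx ⟨i, j⟩).1 r, (hx ⟨i, j⟩).2, ENNReal.ofReal_one]⟩

omit [Fintype E] in
lemma weight_ne_zero (i : Fin I.N) : I.weight i ≠ 0 :=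
  (Nat.lt_of_lt_of_le Nat.zero_lt_one (I.one_le_weight i)).ne'

lemma IsFractional.isProbabilityMeasure_replyLaw (hx : I.IsFractional x) (i : Fin I.N) :
    IsProbabilityMeasure (I.replyLaw x i) := ⟨by
  have := hx.isProbabilityMeasure_subLaw
  simp only [replyLaw, Measure.coe_finsetSum, Measure.coe_smul, Finset.sum_apply, Pi.smul_apply,
    measure_univ, smul_eq_mul, mul_one, Finset.sum_const, Finset.card_univ, Fintype.card_fin,
    nsmul_eq_mul]
  exact ENNReal.mul_inv_cancel (by exact_mod_cast weight_ne_zero i) (ENNReal.natCast_ne_top _)⟩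

lemma IsFractional.integral_replyLaw (hx : I.IsFractional x) (i : Fin I.N)
    (f : I.Reply i → ℝ) :
    ∫ r, f r ∂I.replyLaw x i = (I.weight i : ℝ)⁻¹ * ∑ j, ∑ r, x ⟨i, j⟩ r * f r := by
  have hsub := hx.isProbabilityMeasure_subLaw
  have hfin : ∀ j, ∀ r, IsFiniteMeasure
      (ENNReal.ofReal (x ⟨i, j⟩ r) • Measure.dirac r : Measure (I.Reply i)) := fun j r =>
    Measure.smul_finite _ ENNReal.ofReal_ne_top
  have hw : (I.weight i : ℝ≥0∞)⁻¹ ≠ ∞ := by simpa using weight_ne_zero i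
  have hfin' : ∀ j, IsFiniteMeasure ((I.weight i : ℝ≥0∞)⁻¹ • I.subLaw x i j) := fun j =>
    Measure.smul_finite _ hw
  rw [replyLaw, integral_finsetSum_measure fun j _ => Integrable.of_finite, Finset.mul_sum]
  refine Finset.sum_congr rfl fun j _ => ?_
  rw [integral_smul_measure, subLaw,
    integral_finsetSum_measure fun r _ => (by have := hfin j r; exact Integrable.of_finite)]
  simp only [ENNReal.toReal_inv, ENNReal.toReal_natCast, smul_eq_mul, integral_smul_measure,
    integral_dirac]
  congr 1
  exact Finset.sum_congr rfl fun r _ => by rw [ENNReal.toReal_ofReal ((hx ⟨i, j⟩).1 r)]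

/-- A fixed selection reads one coordinate per request, so the event is a box that is unrestricted
in all other coordinates. -/
lemma IsFractional.roundLaw_select (hx : I.IsFractional x) (j : ∀ i, Fin (I.weight i))
    (A : ∀ i, Set (I.Reply i)) :
    I.roundLaw x {z | ∀ i, z ⟨i, j i⟩ ∈ A i} = ∏ i, I.subLaw x i (j i) (A i) := by
  classical
  have hsub := hx.isProbabilityMeasure_subLaw
  have hset : {z : ∀ s : I.SubRequest, I.Reply s.1 | ∀ i, z ⟨i, j i⟩ ∈ A i} =
      Set.univ.pi fun s : I.SubRequest => if s.2 = j s.1 then A s.1 else Set.univ := by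
    ext z
    simp only [Set.mem_ofPred_eq, Set.mem_pi, Set.mem_univ, true_imp_iff]
    constructor
    · rintro h ⟨i, k⟩
      by_cases hk : k = j i
      · subst hk; simpa using h i
      · simp [hk]
    · intro h i
      simpa using h ⟨i, j i⟩
  rw [hset]
  change Measure.pi (fun s : I.SubRequest => I.subLaw x s.1 s.2) _ = _
  rw [Measure.pi_pi, Fintype.prod_sigma]
  refine Finset.prod_congr rfl fun i _ => ?_
  rw [Finset.prod_eq_single (j i)]
  · simp
  · intro k _ hk
    simp [hk]
  · simp

/-- The requests are served independently. -/
lemma IsFractional.cprLaw_eq_pi (hx : I.IsFractional x) :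
    I.cprLaw x = Measure.pi (I.replyLaw x) := by
  have hrep := hx.isProbabilityMeasure_replyLaw
  have hsub := hx.isProbabilityMeasure_subLaw
  have hround : IsProbabilityMeasure (I.roundLaw x) := by
    change IsProbabilityMeasure (Measure.pi (fun s : I.SubRequest => I.subLaw x s.1 s.2)); infer_instance
  have huni : ∀ i : Fin I.N, IsProbabilityMeasure
      (ProbabilityTheory.uniformOn (Set.univ : Set (Fin (I.weight i)))) := fun i =>
    ProbabilityTheory.isProbabilityMeasure_uniformOn Set.finite_univ
      ⟨⟨0, I.one_le_weight i⟩, trivial⟩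
  have hsel : IsProbabilityMeasure I.selectLaw := by unfold selectLaw; infer_instance
  -- The laws are compared on boxes, conditioning on the selection `j`.
  refine (Measure.pi_eq fun A hA => ?_).symm
  rw [cprLaw, Measure.map_apply Measurable.of_discrete (MeasurableSet.univ_pi hA),
    Measure.prod_apply_symm MeasurableSet.of_discrete, lintegral_fintype]
  have hpre : ∀ j : ∀ i, Fin (I.weight i),
      (fun z => (z, j)) ⁻¹' ((fun z : (∀ s : I.SubRequest, I.Reply s.1) ×
        (∀ i, Fin (I.weight i)) => fun i => z.1 ⟨i, z.2 i⟩) ⁻¹' Set.univ.pi A) =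
      {z | ∀ i, z ⟨i, j i⟩ ∈ A i} := by
    intro j; ext z; simp
  have hone : ∀ j : ∀ i, Fin (I.weight i),
      I.selectLaw {j} = ∏ i, (I.weight i : ℝ≥0∞)⁻¹ := by
    intro j
    rw [selectLaw, Measure.pi_singleton]
    refine Finset.prod_congr rfl fun i _ => ?_
    simp [ProbabilityTheory.uniformOn_univ]
  simp only [hpre, hone, hx.roundLaw_select, ← Finset.prod_mul_distrib]
  simp only [replyLaw, Measure.coe_finsetSum, Measure.coe_smul, Finset.sum_apply, Pi.smul_apply,
    smul_eq_mul]
  -- By distributivity, a product of averages over `Fin (weight i)` is the sum over all selections.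
  rw [Finset.prod_univ_sum, Fintype.piFinset_univ]
  simp only [mul_comm]

/-! ### Expected cost against the objective -/

lemma IsFractional.fracLoadOf_nonneg (hx : I.IsFractional x) (i : Fin I.N) (e : E) :
    0 ≤ I.fracLoadOf x i e := by
  refine Finset.sum_nonneg fun j _ => Finset.sum_nonneg fun r _ => ?_
  split_ifs
  exacts [(hx ⟨i, j⟩).1 r, le_rfl]

-- Used with `c = w_i` for the mean contribution of request `i` to the load and with `c = w_i ^ α`
-- for its `α`-th moment.
open Classical in
lemma IsFractional.integral_ite_mem (hx : I.IsFractional x) (i : Fin I.N) (e : E) (c : ℝ) :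
    ∫ p, (if e ∈ (p i).1 then c else 0) ∂I.cprLaw x =
      (I.weight i : ℝ)⁻¹ * c * I.fracLoadOf x i e := by
  have hrep := hx.isProbabilityMeasure_replyLaw
  rw [hx.cprLaw_eq_pi,
    integral_comp_eval (μ := I.replyLaw x) (i := i) (f := fun r => if e ∈ r.1 then c else 0)
      Measurable.of_discrete.aestronglyMeasurable, hx.integral_replyLaw, mul_assoc, fracLoadOf,
    Finset.mul_sum]
  simp [Finset.mul_sum, mul_comm]

lemma IsFractional.integral_edgeCost_le {α : ℝ} (hα : 1 < α) (hx : I.IsFractional x) (e : E) :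
    ∫ p, I.edgeCost α e (I.load p e) ∂I.cprLaw x ≤
      (α * 2 ^ (α - 1) + (2 ^ (α - 1)) ^ α) * (1 + I.tangentLoad α e) *
        (I.convexCost α e (I.fracLoad x e) +
          I.ξ e * ∑ i, (I.weight i : ℝ) ^ (α - 1) * I.fracLoadOf x i e) := by
  classical
  have hprob := I.isProbabilityMeasure_cprLaw hx
  have hrep := hx.isProbabilityMeasure_replyLaw
  have hint : ∀ f : I.Profile → ℝ, Integrable f (I.cprLaw x) := fun f => Integrable.of_finite
  set X : Fin I.N → I.Profile → ℝ := fun i p => if e ∈ (p i).1 then (I.weight i : ℝ) else 0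
    with hX
  have hload : ∀ p, (I.load p e : ℝ) = ∑ i, X i p := fun p => I.load_cast p e
  have hw : ∀ i, (I.weight i : ℝ) ≠ 0 := fun i => by exact_mod_cast weight_ne_zero i
  have hind : ProbabilityTheory.iIndepFun X (I.cprLaw x) := by
    rw [hx.cprLaw_eq_pi]
    exact ProbabilityTheory.iIndepFun_pi
      (X := fun i (r : I.Reply i) => if e ∈ r.1 then (I.weight i : ℝ) else 0)
      fun i => Measurable.of_discrete.aemeasurable
  have hX1 : ∀ i, ∫ p, X i p ∂I.cprLaw x = I.fracLoadOf x i e := fun i => by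
    rw [hx.integral_ite_mem, inv_mul_cancel₀ (hw i), one_mul]
  have hXα : ∀ i, ∫ p, X i p ^ α ∂I.cprLaw x =
      (I.weight i : ℝ) ^ (α - 1) * I.fracLoadOf x i e := fun i => by
    have : ∀ p, X i p ^ α = if e ∈ (p i).1 then (I.weight i : ℝ) ^ α else 0 := fun p => by
      simp only [hX]
      split_ifs
      exacts [rfl, Real.zero_rpow (by linarith)]
    simp only [this]
    rw [hx.integral_ite_mem, ← Real.rpow_sub_one_mul_self hα (Nat.cast_nonneg _)]
    field_simp [hw i]
  have hmoment := hind.integral_sum_rpow_le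
    (fun i p => by simp only [hX]; split_ifs <;> positivity) hα
  simp only [hXα, hX1, ← hload] at hmoment
  change _ ≤ _ + _ * I.fracLoad x e ^ α at hmoment
  have hmean : ∫ p, (I.load p e : ℝ) ∂I.cprLaw x = I.fracLoad x e := by
    simp only [hload]
    rw [integral_finsetSum _ fun _ _ => hint _]
    simp only [hX1, fracLoad]
  have hmin : ∫ p, min 1 (I.load p e : ℝ) ∂I.cprLaw x ≤ min 1 (I.fracLoad x e) := by
    refine le_min ?_ ?_
    · calc _ ≤ ∫ _, (1 : ℝ) ∂I.cprLaw x := integral_mono (hint _) (hint _) fun p => min_le_left _ _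
        _ = 1 := by simp
    · rw [← hmean]
      exact integral_mono (hint _) (hint _) fun p => min_le_right _ _
  have hl : 0 ≤ I.fracLoad x e := Finset.sum_nonneg fun i _ => hx.fracLoadOf_nonneg i e
  have hS : 0 ≤ ∑ i, (I.weight i : ℝ) ^ (α - 1) * I.fracLoadOf x i e :=
    Finset.sum_nonneg fun i _ => mul_nonneg (by positivity) (hx.fracLoadOf_nonneg i e)
  have hW := I.startup_mul_min_add_le hα e hl
  set S := ∑ i, (I.weight i : ℝ) ^ (α - 1) * I.fracLoadOf x i e
  set l := I.fracLoad x e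
  have hσ := I.σ_nonneg e
  have hξ := (I.ξ_pos e).le
  have hθ := I.tangentLoad_nonneg hα e
  set c : ℝ := 2 ^ (α - 1)
  have hc : 1 ≤ c := Real.one_le_rpow (by norm_num) (by linarith)
  have hcα : 1 ≤ c ^ α := Real.one_le_rpow hc (by linarith)
  have hαc : 1 ≤ α * c := by nlinarith
  -- `C` dominates both Rosenthal constants and is at least `1`, so it also covers the startup term.
  set C := α * c + c ^ α with hC
  have hC1 : 1 ≤ C := by linarith
  have hlα : 0 ≤ l ^ α := by positivity
  have hm0 : 0 ≤ min 1 l := le_min zero_le_one hl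
  calc ∫ p, I.edgeCost α e (I.load p e) ∂I.cprLaw x
      = I.σ e * ∫ p, min 1 (I.load p e : ℝ) ∂I.cprLaw x
        + I.ξ e * ∫ p, (I.load p e : ℝ) ^ α ∂I.cprLaw x := by
        simp only [I.edgeCost_eq hα]
        rw [integral_add (hint _) (hint _), integral_const_mul, integral_const_mul]
    _ ≤ I.σ e * min 1 l + I.ξ e * (α * c * S + c ^ α * l ^ α) := by gcongr
    _ ≤ C * (I.σ e * min 1 l) + I.ξ e * (C * S + C * l ^ α) := by
        have h1 : I.σ e * min 1 l ≤ C * (I.σ e * min 1 l) :=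
          le_mul_of_one_le_left (by positivity) hC1
        have h2 : α * c ≤ C := by linarith
        have h3 : c ^ α ≤ C := by linarith
        gcongr
    _ = C * (I.σ e * min 1 l + I.ξ e * l ^ α + I.ξ e * S) := by ring
    _ ≤ C * ((1 + I.tangentLoad α e) * I.convexCost α e l
          + (1 + I.tangentLoad α e) * (I.ξ e * S)) := by
        have h1 : I.ξ e * S ≤ (1 + I.tangentLoad α e) * (I.ξ e * S) :=
          le_mul_of_one_le_left (by positivity) (by linarith)
        gcongr
    _ = _ := by ring

lemma IsFractional.expectedCost_le {α : ℝ} (hα : 1 < α) (hx : I.IsFractional x) :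
    I.expectedCost α x ≤ (α * 2 ^ (α - 1) + (2 ^ (α - 1)) ^ α) *
      ((1 + (1 / (α - 1)) ^ (1 / α)) * (1 + I.maxRatio ^ (1 / α))) * I.objective α x := by
  have hprob := I.isProbabilityMeasure_cprLaw hx
  have hα1 : 0 < α - 1 := by linarith
  have hM : 0 ≤ I.maxRatio :=
    Real.iSup_nonneg fun e => div_nonneg (I.σ_nonneg e) (I.ξ_pos e).le
  simp only [expectedCost, cost, objective]
  rw [integral_finsetSum _ fun _ _ => Integrable.of_finite, Finset.mul_sum]
  refine Finset.sum_le_sum fun e _ => (hx.integral_edgeCost_le hα e).trans ?_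
  have hl : 0 ≤ I.fracLoad x e := Finset.sum_nonneg fun i _ => hx.fracLoadOf_nonneg i e
  have hS : 0 ≤ ∑ i, (I.weight i : ℝ) ^ (α - 1) * I.fracLoadOf x i e :=
    Finset.sum_nonneg fun i _ => mul_nonneg (by positivity) (hx.fracLoadOf_nonneg i e)
  have hξ := (I.ξ_pos e).le
  have hθ := I.tangentLoad_nonneg hα e
  -- Nonnegativity of the objective's summand is needed to replace `θ_e` by the uniform bound.
  have hW : 0 ≤ I.convexCost α e (I.fracLoad x e) := by
    have h := I.startup_mul_min_add_le hα e hl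
    have h0 : 0 ≤ I.σ e * min 1 (I.fracLoad x e) + I.ξ e * I.fracLoad x e ^ α :=
      add_nonneg (mul_nonneg (I.σ_nonneg e) (le_min zero_le_one hl)) (by positivity)
    exact nonneg_of_mul_nonneg_right (h0.trans h) (by linarith)
  gcongr
  have hD : 0 ≤ (1 / (α - 1)) ^ (1 / α) := by positivity
  have hR : 0 ≤ I.maxRatio ^ (1 / α) := by positivity
  linarith [I.tangentLoad_le hα e]

end EERInstance

end

theorem mainTheorem11 (α : ℝ) (hα : 1 < α) :
    ∃ K : ℝ, 0 < K ∧
      ∀ (V : Type*) (E : Type*) [Fintype E] (I : EERInstance V E), I.Feasible →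
        (∃ x : I.FracProfile, I.IsOptimalFractional α x) ∧
        ∀ x : I.FracProfile, I.IsOptimalFractional α x →
          I.expectedCost α x ≤ K * (1 + I.maxRatio ^ (1 / α)) * I.optCost α := by
  have hα1 : 0 < α - 1 := by linarith
  -- The factor `2` comes from comparing the objective with `C*`, the next from Rosenthal, the last
  -- from bounding `θ_e` by `maxRatio`.
  refine ⟨2 * (α * 2 ^ (α - 1) + (2 ^ (α - 1)) ^ α) * (1 + (1 / (α - 1)) ^ (1 / α)),
    by positivity, fun V E _ I hI => ⟨I.exists_isOptimalFractional hα hI, fun x hx => ?_⟩⟩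
  have hM : 0 ≤ I.maxRatio :=
    Real.iSup_nonneg fun e => div_nonneg (I.σ_nonneg e) (I.ξ_pos e).le
  refine (hx.1.expectedCost_le hα).trans ?_
  calc _ ≤ _ := mul_le_mul_of_nonneg_left (I.objective_le_optCost hα hI hx) (by positivity)
    _ = _ := by ring
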